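/- Let $a_1<0<a_2$, $I_1=(a_1,0)$, $I_2=(0,a_2)$, and put $$P(x)=(x-a_1)\,x^2\,(x-a_2),\qquad Q(x)=2\Bigl(x-\frac{a_1+a_2}{4}\Bigr)^2 .$$ For $j=1,2$ consider the singular Sturm–Liouville problem $$(Pf')'+Qf=\lambda f\ \text{ on } I_j,\qquad P(x)f'(x)\to 0\ \text{ as } x\to a_j,\ x\in I_j .$$ A number $\lambda\in\mathbb{C}$ is called an eigenvalue of this problem if it has a solution $f\in L^2(I_j)$, $f:I_j\to\mathbb{C}$, that is not identically zero. Then: 1. Neither of the two problems ($j=1,2$) has an eigenvalue. 2. If $\lambda$ is real and $\lambda\ge (a_1^2+a_2^2)/8$, then for $j=1,2$ no nonzero solution of $(Pf')'+Qf=\lambda f$ on $I_j$ lies in $L^2(I_j)$, whether or not it satisfies the boundary condition at $a_j$. -/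

import Mathlib

open Set Filter Topology MeasureTheory

/-- The leading coefficient `P(x) = (x - a₁) x² (x - a₂)`. -/
def coeffP (a₁ a₂ x : ℝ) : ℝ := (x - a₁) * x ^ 2 * (x - a₂)

/-- The potential `Q(x) = 2 (x - (a₁ + a₂) / 4)²`. -/
noncomputable def coeffQ (a₁ a₂ x : ℝ) : ℝ := 2 * (x - (a₁ + a₂) / 4) ^ 2

/-- `f` is a (classical, complex-valued) solution of `(P f')' + Q f = lam f` on the open set `I`:
at every point of `I`, `f` is differentiable and `P f'` is differentiable with derivative
`(lam - Q) f`. As `I` is open, only the values of `f` on `I` matter. -/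
def IsSolutionOn (a₁ a₂ : ℝ) (I : Set ℝ) (lam : ℂ) (f : ℝ → ℂ) : Prop :=
  ∀ x ∈ I, DifferentiableAt ℝ f x ∧
    HasDerivAt (fun y : ℝ => (coeffP a₁ a₂ y : ℂ) * deriv f y)
      ((lam - (coeffQ a₁ a₂ x : ℂ)) * f x) x

/-- `f` is square-integrable on `I` with respect to Lebesgue measure. -/
def SquareIntegrableOn (I : Set ℝ) (f : ℝ → ℂ) : Prop :=
  MemLp f 2 (volume.restrict I)

/-- `lam` is an eigenvalue of the singular Sturm–Liouville problem
`(P f')' + Q f = lam f` on `I`, `P(x) f'(x) → 0` as `x → e` within `I`,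
i.e. the problem has a solution in `L²(I)` that does not vanish identically on `I`. -/
def IsSLEigenvalue (a₁ a₂ : ℝ) (I : Set ℝ) (e : ℝ) (lam : ℂ) : Prop :=
  ∃ f : ℝ → ℂ, IsSolutionOn a₁ a₂ I lam f ∧
    Tendsto (fun x : ℝ => (coeffP a₁ a₂ x : ℂ) * deriv f x) (𝓝[I] e) (𝓝 0) ∧
    SquareIntegrableOn I f ∧
    ∃ x ∈ I, f x ≠ 0

/-! Put `p = -a₁a₂`, `s = a₁ + a₂`. The substitution `x = 2p / (d t - s)`, `g(t) = x f(x)`, sends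
the finite endpoint to `t = 1` and the singular point `0` to `t = ∞`. It turns the equation into
Legendre's, with `ν = (s²/8 - λ)/p`. Since `dx` is a constant multiple of `x² dt`, square
integrability is preserved, and `λ ≥ (a₁² + a₂²)/8` becomes `ν ≤ -1/4`.

Square integrability of `g` and `w' = ν g` force `w = o(√t)` and `g = o(1/√t)`, so boundary terms at
infinity vanish. The boundary condition gives `w → 0` at `1`, and then `g` is bounded there.

For nonreal `ν`, the function `Im(w ḡ)` has derivative `Im ν |g|²` and vanishes at both ends. For
real `ν > -1/4`, a Hardy-type identity does the same job with `Re(w ḡ) + (t - 1)|g|²/2`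
(`eq_zero_of_regular`). For real `ν ≤ -1/4`, decay at infinity alone suffices: an energy estimate,
iterated, shows that `g` vanishes for large `t` (`legendre_decay_step`,
`legendre_eq_zero_of_decay`). No condition at `1` is used, which yields the second claim. -/

/-- First-order form of Legendre's equation `((t² - 1) g')' = ν g` on `(1, ∞)`, with
`w = (t² - 1) g'`. -/
def IsLegendreSolution (ν : ℂ) (g w : ℝ → ℂ) : Prop :=
  ∀ t, 1 < t → HasDerivAt g (w t / ((t ^ 2 - 1 : ℝ) : ℂ)) t ∧ HasDerivAt w (ν * g t) t

/-! ### Monotonicity and integration tools -/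

theorem le_of_hasDerivAt_nonneg {F F' : ℝ → ℝ} {a b : ℝ} (hab : a ≤ b)
    (hF : ∀ t ∈ Icc a b, HasDerivAt F (F' t) t) (h : ∀ t ∈ Icc a b, 0 ≤ F' t) : F a ≤ F b := by
  have hm : MonotoneOn F (Icc a b) := by
    refine monotoneOn_of_deriv_nonneg (convex_Icc a b)
      (fun t ht => (hF t ht).continuousAt.continuousWithinAt)
      (fun t ht => (hF t (interior_subset ht)).differentiableAt.differentiableWithinAt) ?_
    intro t ht
    rw [(hF t (interior_subset ht)).deriv]
    exact h t (interior_subset ht)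
  exact hm (left_mem_Icc.2 hab) (right_mem_Icc.2 hab) hab

theorem norm_sub_le_of_hasDerivAt {F F' : ℝ → ℂ} {B B' : ℝ → ℝ} {a b : ℝ} (hab : a ≤ b)
    (hF : ∀ t ∈ Icc a b, HasDerivAt F (F' t) t) (hB : ∀ t ∈ Icc a b, HasDerivAt B (B' t) t)
    (h : ∀ t ∈ Icc a b, ‖F' t‖ ≤ B' t) : ‖F b - F a‖ ≤ B b - B a := by
  refine image_norm_le_of_norm_deriv_right_le_deriv_boundary'
    (f := fun t => F t - F a) (f' := F') (B := fun t => B t - B a) (B' := B')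
    ?_ ?_ (by simp) ?_ ?_ ?_ (right_mem_Icc.2 hab)
  · exact fun t ht => ((hF t ht).sub_const _).continuousAt.continuousWithinAt
  · exact fun t ht => ((hF t (Ico_subset_Icc_self ht)).sub_const _).hasDerivWithinAt
  · exact fun t ht => ((hB t ht).sub_const _).continuousAt.continuousWithinAt
  · exact fun t ht => ((hB t (Ico_subset_Icc_self ht)).sub_const _).hasDerivWithinAt
  · exact fun t ht => h t (Ico_subset_Icc_self ht)

theorem nonpos_of_hasDerivAt_nonneg_of_tendsto {F F' : ℝ → ℝ} {T : ℝ}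
    (hF : ∀ t, T ≤ t → HasDerivAt F (F' t) t) (h : ∀ t, T ≤ t → 0 ≤ F' t)
    (hlim : Tendsto F atTop (𝓝 0)) {t : ℝ} (ht : T ≤ t) : F t ≤ 0 := by
  refine ge_of_tendsto hlim ?_
  filter_upwards [eventually_ge_atTop t] with s hs
  exact le_of_hasDerivAt_nonneg hs (fun r hr => hF r (ht.trans hr.1)) (fun r hr => h r (ht.trans hr.1))

/-- The limit at infinity bounds the monotone `F` above by `0`, the limit at `a` bounds it below, so
`F` is constant. Every energy argument in `eq_zero_of_regular` ends here. -/
theorem deriv_eq_zero_of_tendsto {F F' : ℝ → ℝ} {a : ℝ}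
    (hF : ∀ t, a < t → HasDerivAt F (F' t) t) (h : ∀ t, a < t → 0 ≤ F' t)
    (hleft : Tendsto F (𝓝[>] a) (𝓝 0)) (hlim : Tendsto F atTop (𝓝 0)) {t : ℝ} (ht : a < t) :
    F' t = 0 := by
  have key : ∀ t, a < t → F t = 0 := by
    intro t ht
    refine le_antisymm (nonpos_of_hasDerivAt_nonneg_of_tendsto (T := t)
      (fun s hs => hF s (ht.trans_le hs)) (fun s hs => h s (ht.trans_le hs)) hlim le_rfl) ?_
    refine le_of_tendsto hleft ?_
    filter_upwards [Ioo_mem_nhdsGT ht] with s hs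
    exact le_of_hasDerivAt_nonneg hs.2.le (fun r hr => hF r (hs.1.trans_le hr.1))
      (fun r hr => h r (hs.1.trans_le hr.1))
  have h0 : HasDerivAt F 0 t := by
    refine (hasDerivAt_const t (0 : ℝ)).congr_of_eventuallyEq ?_
    filter_upwards [lt_mem_nhds ht] with s hs using key s hs
  exact (hF t ht).unique h0

theorem hasDerivAt_inv_sqrt {t : ℝ} (ht : 0 < t) :
    HasDerivAt (fun s : ℝ => (√s)⁻¹) (-(1 / (2 * √t * t))) t := by
  have h := (Real.hasDerivAt_sqrt ht.ne').inv (Real.sqrt_pos.2 ht).ne'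
  rw [Real.sq_sqrt ht.le, neg_div, div_div] at h
  exact h

/-- The square integral of `g` from `1`, as a bounded primitive of `|g|²`. -/
theorem exists_primitive_norm_sq {g : ℝ → ℂ} (hc : ∀ t, 1 < t → ContinuousAt g t)
    (hg : IntegrableOn (fun t => ‖g t‖ ^ 2) (Ioi 1)) :
    ∃ (Φ : ℝ → ℝ) (L : ℝ), (∀ t, 1 < t → HasDerivAt Φ (‖g t‖ ^ 2) t) ∧
      Tendsto Φ atTop (𝓝 L) ∧ ∀ t, 1 < t → 0 ≤ Φ t ∧ Φ t ≤ L := by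
  have hd : ∀ t, 1 < t → HasDerivAt (fun t => ∫ s in (1 : ℝ)..t, ‖g s‖ ^ 2) (‖g t‖ ^ 2) t := by
    intro t ht
    refine intervalIntegral.integral_hasDerivAt_right ?_ ?_ ?_
    · rw [intervalIntegrable_iff_integrableOn_Ioc_of_le ht.le]
      exact hg.mono_set Ioc_subset_Ioi_self
    · exact ⟨Ioi 1, Ioi_mem_nhds ht, hg.aestronglyMeasurable⟩
    · exact (hc t ht).norm.pow 2
  have hl := intervalIntegral_tendsto_integral_Ioi 1 hg tendsto_id
  refine ⟨_, _, hd, hl, fun t ht => ⟨?_, ?_⟩⟩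
  · exact intervalIntegral.integral_nonneg ht.le fun s _ => by positivity
  · refine ge_of_tendsto hl ?_
    filter_upwards [eventually_ge_atTop t] with s hs
    exact le_of_hasDerivAt_nonneg hs (fun r hr => hd r (ht.trans_le hr.1)) (fun r _ => by positivity)

/-! ### Growth of square-integrable solutions at infinity and at 1 -/

namespace IsLegendreSolution

variable {ν : ℂ} {g w : ℝ → ℂ}

/-- Cauchy–Schwarz for `∫ |g|` in the form `2|g| ≤ η + |g|²/η`; leaving `η` free makes both sides
explicit primitives. -/
theorem norm_sub_le (h : IsLegendreSolution ν g w) {Φ : ℝ → ℝ}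
    (hΦ : ∀ t, 1 < t → HasDerivAt Φ (‖g t‖ ^ 2) t) {s t η : ℝ} (hs : 1 < s) (hst : s ≤ t)
    (hη : 0 < η) : ‖w t - w s‖ ≤ ‖ν‖ * (η * (t - s) + (Φ t - Φ s) / η) / 2 := by
  have := norm_sub_le_of_hasDerivAt (F := w) (F' := fun r => ν * g r)
    (B := fun r => ‖ν‖ * (η * r + Φ r / η) / 2) (B' := fun r => ‖ν‖ * (η * 1 + ‖g r‖ ^ 2 / η) / 2)
    hst (fun r hr => (h r (hs.trans_le hr.1)).2)
    (fun r hr => ((((hasDerivAt_id r).const_mul η).add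
      ((hΦ r (hs.trans_le hr.1)).div_const η)).const_mul ‖ν‖).div_const 2) ?_
  · refine this.trans (le_of_eq ?_)
    simp only [sub_div]
    ring
  · intro r _
    rw [norm_mul, mul_div_assoc]
    refine mul_le_mul_of_nonneg_left ?_ (norm_nonneg _)
    rw [le_div_iff₀ two_pos, mul_one, ← sub_nonneg]
    have : η + ‖g r‖ ^ 2 / η - ‖g r‖ * 2 = (η - ‖g r‖) ^ 2 / η := by field_simp; ring
    rw [this]; positivity

theorem exists_holder (h : IsLegendreSolution ν g w)
    (hg : IntegrableOn (fun t => ‖g t‖ ^ 2) (Ioi 1)) :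
    ∃ K : ℝ, 0 ≤ K ∧ ∀ s t, 1 < s → s < t → ‖w t - w s‖ ≤ K * √(t - s) := by
  obtain ⟨Φ, L, hΦ, -, hb⟩ := exists_primitive_norm_sq (fun t ht => (h t ht).1.continuousAt) hg
  have hL : 0 ≤ L := (hb 2 (by norm_num)).1.trans (hb 2 (by norm_num)).2
  refine ⟨‖ν‖ * (1 + L) / 2, by positivity, fun s t hs hst => ?_⟩
  have hp : 0 < √(t - s) := Real.sqrt_pos.2 (sub_pos.2 hst)
  -- `η = 1/√(t - s)` makes both terms of the bound of order `√(t - s)`.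
  refine (h.norm_sub_le hΦ hs hst.le (inv_pos.2 hp)).trans ?_
  have h1 : (√(t - s))⁻¹ * (t - s) = √(t - s) := by
    nth_rewrite 2 [← Real.mul_self_sqrt (sub_pos.2 hst).le]
    field_simp
  rw [h1, div_inv_eq_mul]
  have : (Φ t - Φ s) * √(t - s) ≤ L * √(t - s) :=
    mul_le_mul_of_nonneg_right (by linarith [(hb s hs).1, (hb t (hs.trans hst)).2]) hp.le
  nlinarith [norm_nonneg ν]

theorem isLittleO_sqrt (h : IsLegendreSolution ν g w)
    (hg : IntegrableOn (fun t => ‖g t‖ ^ 2) (Ioi 1)) {ε : ℝ} (hε : 0 < ε) :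
    ∀ᶠ t in atTop, ‖w t‖ ≤ ε * √t := by
  obtain ⟨Φ, L, hΦ, hlim, hb⟩ := exists_primitive_norm_sq (fun t ht => (h t ht).1.continuousAt) hg
  set δ := ε / (2 * (‖ν‖ + 1)) with hδ
  have hδ0 : 0 < δ := by positivity
  have hνδ : ‖ν‖ * δ ≤ ε / 2 := by
    rw [hδ, mul_div_assoc', div_le_div_iff₀ (by positivity) two_pos]
    nlinarith [norm_nonneg ν]
  -- Beyond `T` the remaining mass of `|g|²` is below `δ²`; with `η = δ/√t` both terms are then at
  -- most `δ√t`.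
  obtain ⟨T, hT, hT1⟩ := ((hlim.eventually (lt_mem_nhds (show L - δ ^ 2 < L by
    have := pow_pos hδ0 2; linarith))).and (eventually_gt_atTop 1)).exists
  have hw := (tendsto_const_nhds (x := ‖w T‖)).div_atTop Real.tendsto_sqrt_atTop
  filter_upwards [eventually_ge_atTop T, hw.eventually (gt_mem_nhds (half_pos hε))] with t ht hwt
  have ht0 : 0 < t := by linarith
  have hp : 0 < √t := Real.sqrt_pos.2 ht0
  rw [div_lt_iff₀ hp] at hwt
  have h1 := h.norm_sub_le hΦ hT1 ht (div_pos hδ0 hp)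
  have h2 : δ / √t * (t - T) ≤ δ * √t := by
    rw [div_mul_eq_mul_div, div_le_iff₀ hp, mul_assoc, Real.mul_self_sqrt ht0.le]
    exact mul_le_mul_of_nonneg_left (by linarith) hδ0.le
  have h3 : (Φ t - Φ T) / (δ / √t) ≤ δ * √t := by
    rw [div_div_eq_mul_div, div_le_iff₀ hδ0]
    have : Φ t - Φ T ≤ δ ^ 2 := by linarith [(hb t (hT1.trans_le ht)).2]
    nlinarith
  have h4 : ‖w t‖ ≤ ‖w T‖ + ‖w t - w T‖ := by
    simpa using norm_add_le (w T) (w t - w T)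
  have h5 : ‖ν‖ * (δ / √t * (t - T) + (Φ t - Φ T) / (δ / √t)) ≤ ‖ν‖ * (2 * (δ * √t)) :=
    mul_le_mul_of_nonneg_left (by linarith) (norm_nonneg _)
  nlinarith

theorem exists_norm_lt (hg : IntegrableOn (fun t => ‖g t‖ ^ 2) (Ioi 1)) {δ : ℝ} (hδ : 0 < δ)
    (T : ℝ) : ∃ s, T ≤ s ∧ ‖g s‖ < δ := by
  by_contra! hcon
  have hi : IntegrableOn (fun t => ‖g t‖ ^ 2) (Ioi (max 1 T)) :=
    hg.mono_set (Ioi_subset_Ioi (le_max_left _ _))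
  have hconst : IntegrableOn (fun _ : ℝ => δ ^ 2) (Ioi (max 1 T)) := by
    refine Integrable.mono' hi aestronglyMeasurable_const ?_
    filter_upwards [ae_restrict_mem measurableSet_Ioi] with s hs
    rw [Real.norm_of_nonneg (by positivity)]
    exact pow_le_pow_left₀ hδ.le (hcon s ((le_max_right _ _).trans (le_of_lt hs))) 2
  rw [integrableOn_const_iff] at hconst
  simp [hδ.ne'] at hconst

/-- The bound on `w` makes `g'` of size `o(t^(-3/2))`. Integrating it from `t` to a later point
where `g` is as small as desired avoids assuming `g → 0`. -/
theorem isLittleO_inv_sqrt (h : IsLegendreSolution ν g w)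
    (hg : IntegrableOn (fun t => ‖g t‖ ^ 2) (Ioi 1)) {ε : ℝ} (hε : 0 < ε) :
    ∀ᶠ t in atTop, ‖g t‖ ≤ ε * (√t)⁻¹ := by
  obtain ⟨T, hT⟩ := eventually_atTop.1 (h.isLittleO_sqrt hg (show 0 < ε / 5 by positivity))
  filter_upwards [eventually_ge_atTop T, eventually_ge_atTop 2] with t ht ht2
  have ht0 : 0 < t := by linarith
  have hp : 0 < √t := Real.sqrt_pos.2 ht0
  obtain ⟨s, hs, hgs⟩ := exists_norm_lt hg (show 0 < ε / 5 * (√t)⁻¹ by positivity) t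
  have hB := norm_sub_le_of_hasDerivAt (F := g) (F' := fun r => w r / ((r ^ 2 - 1 : ℝ) : ℂ))
    (B := fun r => -(4 * (ε / 5)) * (√r)⁻¹)
    (B' := fun r => -(4 * (ε / 5)) * -(1 / (2 * √r * r))) hs
    (fun r hr => (h r (by linarith [hr.1])).1)
    (fun r hr => (hasDerivAt_inv_sqrt (by linarith [hr.1])).const_mul _) ?_
  · have h4 : ‖g t‖ ≤ ‖g s‖ + ‖g s - g t‖ := by
      rw [norm_sub_rev]
      simpa using norm_add_le (g s) (g t - g s)
    have : 0 ≤ (4 * (ε / 5)) * (√s)⁻¹ := by positivity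
    simp only [neg_mul] at hB
    linarith
  · intro r hr
    have hr2 : 2 ≤ r := ht2.trans hr.1
    have hrp : 0 < √r := Real.sqrt_pos.2 (by linarith)
    have hA : 0 < r ^ 2 - 1 := by nlinarith
    rw [norm_div, Complex.norm_real, Real.norm_of_nonneg hA.le, div_le_iff₀ hA]
    refine (hT r (ht.trans hr.1)).trans ?_
    have : -(4 * (ε / 5)) * -(1 / (2 * √r * r)) * (r ^ 2 - 1)
        = ε / 5 * (2 * (r ^ 2 - 1) / (√r * r)) := by field_simp; ring
    rw [this]
    refine mul_le_mul_of_nonneg_left ?_ (by positivity)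
    rw [le_div_iff₀ (by positivity), ← mul_assoc, Real.mul_self_sqrt (by linarith)]
    nlinarith

theorem tendsto_div_sqrt (h : IsLegendreSolution ν g w)
    (hg : IntegrableOn (fun t => ‖g t‖ ^ 2) (Ioi 1)) :
    Tendsto (fun t => w t / ((√t : ℝ) : ℂ)) atTop (𝓝 0) := by
  rw [NormedAddGroup.tendsto_nhds_zero]
  intro ε hε
  filter_upwards [h.isLittleO_sqrt hg (half_pos hε), eventually_gt_atTop 0] with t ht ht0
  have hp : 0 < √t := Real.sqrt_pos.2 ht0
  rw [norm_div, Complex.norm_real, Real.norm_of_nonneg hp.le, div_lt_iff₀ hp]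
  nlinarith

theorem tendsto_sqrt_mul (h : IsLegendreSolution ν g w)
    (hg : IntegrableOn (fun t => ‖g t‖ ^ 2) (Ioi 1)) :
    Tendsto (fun t => ((√t : ℝ) : ℂ) * g t) atTop (𝓝 0) := by
  rw [NormedAddGroup.tendsto_nhds_zero]
  intro ε hε
  filter_upwards [h.isLittleO_inv_sqrt hg (half_pos hε), eventually_gt_atTop 0] with t ht ht0
  have hp : 0 < √t := Real.sqrt_pos.2 ht0
  rw [norm_mul, Complex.norm_real, Real.norm_of_nonneg hp.le]
  rw [← div_eq_mul_inv, le_div_iff₀ hp] at ht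
  linarith

/-- A square-integrable solution grows at most logarithmically at `1`. -/
theorem tendsto_sub_one_mul (h : IsLegendreSolution ν g w)
    (hg : IntegrableOn (fun t => ‖g t‖ ^ 2) (Ioi 1)) :
    Tendsto (fun t : ℝ => ((t - 1 : ℝ) : ℂ) * g t) (𝓝[>] 1) (𝓝 0) := by
  obtain ⟨K, hK, hw⟩ := h.exists_holder hg
  set C := ‖w 2‖ + K
  have hC : ∀ t, 1 < t → t ≤ 2 → ‖w t‖ ≤ C := by
    intro t ht ht2
    rcases ht2.lt_or_eq with h2 | rfl
    · have h1 := hw t 2 ht h2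
      have h3 : √(2 - t) ≤ 1 := Real.sqrt_le_one.2 (by linarith)
      have h4 : ‖w t‖ ≤ ‖w 2‖ + ‖w 2 - w t‖ := by
        rw [norm_sub_rev]
        simpa using norm_add_le (w 2) (w t - w 2)
      nlinarith
    · exact le_add_of_nonneg_right hK
  have hlog : ∀ t, 1 < t → t ≤ 2 → ‖g t‖ ≤ ‖g 2‖ + -(C * Real.log (t - 1)) := by
    intro t ht ht2
    have hB := norm_sub_le_of_hasDerivAt (F := g) (F' := fun r => w r / ((r ^ 2 - 1 : ℝ) : ℂ))
      (B := fun r => C * Real.log (r - 1)) (B' := fun r => C * (1 / (r - 1))) ht2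
      (fun r hr => (h r (ht.trans_le hr.1)).1)
      (fun r hr => (((hasDerivAt_id r).sub_const 1).log
        (by simp only [id]; linarith [hr.1])).const_mul C) ?_
    · have h4 : ‖g t‖ ≤ ‖g 2‖ + ‖g 2 - g t‖ := by
        rw [norm_sub_rev]
        simpa using norm_add_le (g 2) (g t - g 2)
      norm_num at hB
      linarith
    · intro r hr
      have hr1 : 0 < r - 1 := by linarith [hr.1]
      have hA : 0 < r ^ 2 - 1 := by nlinarith
      rw [norm_div, Complex.norm_real, Real.norm_of_nonneg hA.le, mul_one_div]
      have := hC r (ht.trans_le hr.1) hr.2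
      exact div_le_div₀ ((norm_nonneg _).trans this) this hr1 (by nlinarith)
  have hsub : Tendsto (fun t : ℝ => t - 1) (𝓝[>] 1) (𝓝[>] 0) := by
    refine tendsto_nhdsWithin_iff.2 ⟨?_, ?_⟩
    · have : Tendsto (fun t : ℝ => t - 1) (𝓝 1) (𝓝 (1 - 1)) :=
        (continuous_id.sub continuous_const).tendsto 1
      rw [sub_self] at this
      exact this.mono_left nhdsWithin_le_nhds
    · filter_upwards [self_mem_nhdsWithin] with t ht using sub_pos.2 (mem_Ioi.1 ht)
  have hl := ((by simpa using Real.continuous_mul_log.tendsto 0 :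
    Tendsto (fun r => r * Real.log r) (𝓝 0) (𝓝 0)).comp
      (hsub.mono_right nhdsWithin_le_nhds)).const_mul C
  have hc := (hsub.mono_right nhdsWithin_le_nhds).mul_const ‖g 2‖
  have := hc.sub hl
  rw [zero_mul, mul_zero, sub_zero] at this
  refine squeeze_zero_norm' ?_ this
  filter_upwards [Ioc_mem_nhdsGT (show (1 : ℝ) < 2 by norm_num)] with t ht
  have ht1 : 0 < t - 1 := sub_pos.2 ht.1
  rw [norm_mul, Complex.norm_real, Real.norm_of_nonneg ht1.le]
  have := mul_le_mul_of_nonneg_left (hlog t ht.1 ht.2) ht1.le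
  simp only [Function.comp]
  linarith

/-- Letting `s → 1` in the Hölder bound gives `|w| ≤ K √(t - 1)`, so `g'` is dominated by the
derivative of `K √(t - 1)`, which is integrable at `1`. -/
theorem exists_bounds_near_one (h : IsLegendreSolution ν g w)
    (hg : IntegrableOn (fun t => ‖g t‖ ^ 2) (Ioi 1)) (hw0 : Tendsto w (𝓝[>] 1) (𝓝 0)) :
    ∃ C : ℝ, ∀ t, 1 < t → t ≤ 2 → ‖g t‖ ≤ C := by
  obtain ⟨K, hK, hw⟩ := h.exists_holder hg
  have hwK : ∀ t, 1 < t → ‖w t‖ ≤ K * √(t - 1) := by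
    intro t ht
    have hl : Tendsto (fun s => ‖w t - w s‖) (𝓝[>] 1) (𝓝 ‖w t - 0‖) :=
      (tendsto_const_nhds.sub hw0).norm
    have hr : Tendsto (fun s : ℝ => K * √(t - s)) (𝓝[>] 1) (𝓝 (K * √(t - 1))) :=
      ((by fun_prop : Continuous fun s : ℝ => K * √(t - s)).tendsto 1).mono_left nhdsWithin_le_nhds
    rw [sub_zero] at hl
    refine le_of_tendsto_of_tendsto hl hr ?_
    filter_upwards [Ioo_mem_nhdsGT ht] with s hs using hw s t hs.1 hs.2
  refine ⟨‖g 2‖ + K, fun t ht ht2 => ?_⟩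
  have hB := norm_sub_le_of_hasDerivAt (F := g) (F' := fun r => w r / ((r ^ 2 - 1 : ℝ) : ℂ))
    (B := fun r => K * √(r - 1)) (B' := fun r => K * (1 / (2 * √(r - 1)))) ht2
    (fun r hr => (h r (ht.trans_le hr.1)).1)
    (fun r hr => (((hasDerivAt_id r).sub_const 1).sqrt
      (by simp only [id]; linarith [hr.1])).const_mul K) ?_
  · have h4 : ‖g t‖ ≤ ‖g 2‖ + ‖g 2 - g t‖ := by
      rw [norm_sub_rev]
      simpa using norm_add_le (g 2) (g t - g 2)
    norm_num at hB
    have : 0 ≤ K * √(t - 1) := by positivity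
    linarith
  · intro r hr
    have hr1 : 0 < r - 1 := by linarith [hr.1]
    have hp : 0 < √(r - 1) := Real.sqrt_pos.2 hr1
    have hA : 0 < r ^ 2 - 1 := by nlinarith
    rw [norm_div, Complex.norm_real, Real.norm_of_nonneg hA.le, div_le_iff₀ hA]
    refine (hwK r (ht.trans_le hr.1)).trans ?_
    rw [mul_assoc]
    refine mul_le_mul_of_nonneg_left ?_ hK
    rw [one_div_mul_eq_div, le_div_iff₀ (by positivity)]
    have : √(r - 1) * (2 * √(r - 1)) = 2 * (r - 1) := by
      rw [mul_left_comm, Real.mul_self_sqrt hr1.le]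
    rw [this]; nlinarith

end IsLegendreSolution

/-! ### Real parameter at most -1/4: uniqueness from decay at infinity -/

section RealLegendre

variable {ν : ℝ} {g w : ℝ → ℝ}

/-- One step of the decay iteration: it gains a factor `1 / 4` in a bound for `t³ g'²`. -/
theorem legendre_decay_step (hν : ν ≤ -(1 / 4))
    (hg : ∀ t, 1 < t → HasDerivAt g (w t / (t ^ 2 - 1)) t)
    (hw : ∀ t, 1 < t → HasDerivAt w (ν * g t) t)
    (hwlim : Tendsto (fun t => w t / √t) atTop (𝓝 0))
    (hglim : Tendsto (fun t => √t * g t) atTop (𝓝 0))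
    {T m : ℝ} (hT : 5 ≤ T) (hm : 0 ≤ m)
    (hb : ∀ t, T ≤ t → (w t / (t ^ 2 - 1)) ^ 2 * t ^ 3 ≤ m) :
    ∀ t, T ≤ t → (w t / (t ^ 2 - 1)) ^ 2 * t ^ 3 ≤ m / 4 ∧ g t ^ 2 * t ^ 3 ≤ 2 * m := by
  have hA : ∀ t, T ≤ t → 0 < t ^ 2 - 1 := fun t ht => by nlinarith
  -- Here `w / (t² - 1)` is `g'`. The energy `N = t (w²/(t² - 1) - ν g²) + g w` satisfies `N' = -2
  -- g'²`, so the bound `g'² ≤ m/t³` integrates to `N ≤ m/t²`.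
  have hNlim : Tendsto (fun t => t * (w t ^ 2 / (t ^ 2 - 1) - ν * g t ^ 2) + g t * w t)
      atTop (𝓝 0) := by
    have h1 : Tendsto (fun t : ℝ => 1 + (t ^ 2 - 1)⁻¹) atTop (𝓝 (1 + 0)) :=
      tendsto_const_nhds.add (tendsto_inv_atTop_zero.comp
        (tendsto_atTop_add_const_right _ _ (tendsto_pow_atTop two_ne_zero)))
    have h2 := ((h1.mul (hwlim.pow 2)).sub ((hglim.pow 2).const_mul ν)).add (hglim.mul hwlim)
    norm_num at h2
    refine h2.congr' ?_
    filter_upwards [eventually_ge_atTop T] with t ht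
    have hp : 0 < √t := Real.sqrt_pos.2 (by linarith)
    have hs : √t ^ 2 = t := Real.sq_sqrt (by linarith)
    have hA' := (hA t ht).ne'
    have ht0 : t ≠ 0 := by linarith
    rw [mul_pow, div_pow, hs]
    field_simp
    ring
  have hN : ∀ t, T ≤ t →
      t * (w t ^ 2 / (t ^ 2 - 1) - ν * g t ^ 2) + g t * w t ≤ m / t ^ 2 := by
    intro t ht
    have hinv : Tendsto (fun t : ℝ => m / t ^ 2) atTop (𝓝 0) :=
      tendsto_const_nhds.div_atTop (tendsto_pow_atTop two_ne_zero)
    have hlim := hNlim.sub hinv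
    rw [sub_zero] at hlim
    have := nonpos_of_hasDerivAt_nonneg_of_tendsto (T := T)
      (F' := fun t => -2 * (w t / (t ^ 2 - 1)) ^ 2 + 2 * m / t ^ 3) ?_ ?_ hlim ht
    · linarith
    · intro t ht
      have hA' := (hA t ht).ne'
      have ht0 : t ≠ 0 := by linarith
      have h1 := hg t (by linarith)
      have h2 := hw t (by linarith)
      have h3 := ((((hasDerivAt_id t).mul (((h2.pow 2).div
        (((hasDerivAt_id t).pow 2).sub_const 1) hA').sub ((h1.pow 2).const_mul ν))).add
        (h1.mul h2))).sub ((hasDerivAt_const t m).div ((hasDerivAt_id t).pow 2) (pow_ne_zero 2 ht0))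
      refine h3.congr_deriv ?_
      simp only [id, Pi.pow_apply, Pi.sub_apply, Pi.div_apply]
      field_simp
      ring
    · intro t ht
      have ht0 : 0 < t ^ 3 := by have : 0 < t := by linarith
                                 positivity
      have := (le_div_iff₀ ht0).2 (hb t ht)
      rw [mul_div_assoc]
      linarith
  have hk : ∀ t, T ≤ t → (w t / (t ^ 2 - 1) + g t / (2 * t)) ^ 2 * t ^ 5 ≤ 2 * m := by
    intro t ht
    have ht0 : 0 < t := by linarith
    have h1 := hN t ht
    -- Completing the square: for `ν ≤ -1/4` the energy is a sum of nonnegative terms. The square it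
    -- controls is that of `(√t g)' / √t`.
    have h2 : t * (w t ^ 2 / (t ^ 2 - 1) - ν * g t ^ 2) + g t * w t
        = t * (t ^ 2 - 1) * (w t / (t ^ 2 - 1) + g t / (2 * t)) ^ 2
          + g t ^ 2 / (4 * t) + (-(1 / 4) - ν) * t * g t ^ 2 := by
      have hA' := (hA t ht).ne'
      field_simp
      ring
    have h3 : 0 ≤ g t ^ 2 / (4 * t) := by positivity
    have h4 : 0 ≤ (-(1 / 4) - ν) * t * g t ^ 2 := by
      have : 0 ≤ -(1 / 4) - ν := by linarith
      positivity
    set X := (w t / (t ^ 2 - 1) + g t / (2 * t)) ^ 2 with hX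
    have h5 : t * (t ^ 2 - 1) * X ≤ m / t ^ 2 := by linarith
    rw [le_div_iff₀ (by positivity)] at h5
    have hX0 : 0 ≤ X := sq_nonneg _
    have : 0 ≤ X * t ^ 3 * (t ^ 2 - 2) := by
      have : 0 ≤ t ^ 2 - 2 := by nlinarith
      positivity
    nlinarith
  have hkd : ∀ t, T ≤ t → HasDerivAt (fun t => √t * g t)
      (√t * (w t / (t ^ 2 - 1) + g t / (2 * t))) t := by
    intro t ht
    have ht0 : 0 < t := by linarith
    have hp : 0 < √t := Real.sqrt_pos.2 ht0
    have hs : √t ^ 2 = t := Real.sq_sqrt ht0.le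
    refine ((Real.hasDerivAt_sqrt ht0.ne').mul (hg t (by linarith))).congr_deriv ?_
    have hA' := (hA t ht).ne'
    field_simp
    rw [hs]
    ring
  have hkb : ∀ t, T ≤ t → |√t * (w t / (t ^ 2 - 1) + g t / (2 * t))| ≤ √(2 * m) / t ^ 2 := by
    intro t ht
    have ht0 : 0 < t := by linarith
    rw [le_div_iff₀ (by positivity)]
    refine Real.le_sqrt_of_sq_le ?_
    rw [mul_pow, sq_abs, mul_pow, Real.sq_sqrt ht0.le]
    refine le_trans (le_of_eq ?_) (hk t ht)
    ring
  have hinv : Tendsto (fun t : ℝ => √(2 * m) / t) atTop (𝓝 0) :=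
    tendsto_const_nhds.div_atTop tendsto_id
  have hinvd : ∀ t : ℝ, T ≤ t → HasDerivAt (fun t => √(2 * m) / t) (-(√(2 * m) / t ^ 2)) t := by
    intro t ht
    have ht0 : t ≠ 0 := by linarith
    refine ((hasDerivAt_const t (√(2 * m))).div (hasDerivAt_id t) ht0).congr_deriv ?_
    simp [neg_div]
  have hg2 : ∀ t, T ≤ t → g t ^ 2 * t ^ 3 ≤ 2 * m := by
    intro t ht
    have ht0 : 0 < t := by linarith
    have hu := nonpos_of_hasDerivAt_nonneg_of_tendsto (T := T)
      (fun s hs => (hkd s hs).sub (hinvd s hs))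
      (fun s hs => by linarith [neg_le_of_abs_le (hkb s hs)])
      (by rw [← sub_zero (0 : ℝ)]; exact hglim.sub hinv) ht
    have hl := nonpos_of_hasDerivAt_nonneg_of_tendsto (T := T)
      (fun s hs => (hkd s hs).neg.sub (hinvd s hs))
      (fun s hs => by linarith [le_of_abs_le (hkb s hs)])
      (by have := hglim.neg.sub hinv; rwa [neg_zero, sub_zero] at this) ht
    simp only [Pi.sub_apply, Pi.neg_apply] at hu hl
    have h1 : |√t * g t| ≤ √(2 * m) / t := abs_le.2 ⟨by linarith, by linarith⟩
    have h2 := pow_le_pow_left₀ (abs_nonneg _) h1 2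
    rw [sq_abs, mul_pow, Real.sq_sqrt ht0.le, div_pow, Real.sq_sqrt (by positivity),
      le_div_iff₀ (by positivity)] at h2
    linarith
  intro t ht
  refine ⟨?_, hg2 t ht⟩
  have ht0 : 0 < t := by linarith
  set y := w t / (t ^ 2 - 1)
  have h1 := hk t ht
  have h2 := hg2 t ht
  have h3 : y ^ 2 ≤ 2 * (y + g t / (2 * t)) ^ 2 + 2 * (g t / (2 * t)) ^ 2 := by
    nlinarith [sq_nonneg (y + 2 * (g t / (2 * t)))]
  have h4 : (g t / (2 * t)) ^ 2 * t ^ 5 = g t ^ 2 * t ^ 3 / 4 := by field_simp; norm_num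
  have h5 : y ^ 2 * t ^ 5 ≤ 5 * m := by
    have := mul_le_mul_of_nonneg_right h3 (pow_nonneg ht0.le 5)
    nlinarith
  have h6 : 0 ≤ y ^ 2 * t ^ 3 := by positivity
  -- `T ≥ 5` gives `t² ≥ 20`, which turns the factor `5` of `h5` into `1/4`.
  have h7 : y ^ 2 * t ^ 3 * 20 ≤ y ^ 2 * t ^ 3 * t ^ 2 :=
    mul_le_mul_of_nonneg_left (by nlinarith) h6
  have h8 : y ^ 2 * t ^ 3 * t ^ 2 = y ^ 2 * t ^ 5 := by ring
  linarith

/-- For `ν ≤ -1/4` the zero solution of Legendre's equation is the only one that decays faster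
than `t ^ (-1/2)`. -/
theorem legendre_eq_zero_of_decay (hν : ν ≤ -(1 / 4))
    (hg : ∀ t, 1 < t → HasDerivAt g (w t / (t ^ 2 - 1)) t)
    (hw : ∀ t, 1 < t → HasDerivAt w (ν * g t) t)
    (hwlim : Tendsto (fun t => w t / √t) atTop (𝓝 0))
    (hglim : Tendsto (fun t => √t * g t) atTop (𝓝 0)) {t : ℝ} (ht : 1 < t) : g t = 0 := by
  obtain ⟨T₀, hT₀⟩ := eventually_atTop.1
    ((by simpa using hwlim.pow 2 : Tendsto (fun t => (w t / √t) ^ 2) atTop (𝓝 0)).eventually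
      (gt_mem_nhds one_pos))
  set T := max T₀ 5
  have hT : 5 ≤ T := le_max_right _ _
  -- The iteration starts at `m = 4`, from `w² < t` and `t² ≤ 2(t² - 1)`.
  have hb0 : ∀ t, T ≤ t → (w t / (t ^ 2 - 1)) ^ 2 * t ^ 3 ≤ 4 := by
    intro t ht
    have ht5 : 5 ≤ t := hT.trans ht
    have ht0 : 0 < t := by linarith
    have h1 := hT₀ t ((le_max_left _ _).trans ht)
    rw [div_pow, Real.sq_sqrt ht0.le, div_lt_one ht0] at h1
    have hA : 0 < t ^ 2 - 1 := by nlinarith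
    rw [div_pow, div_mul_eq_mul_div, div_le_iff₀ (by positivity)]
    have h2 : w t ^ 2 * t ^ 3 ≤ t * t ^ 3 := mul_le_mul_of_nonneg_right h1.le (by positivity)
    have h3 : (t ^ 2) ^ 2 ≤ (2 * (t ^ 2 - 1)) ^ 2 :=
      pow_le_pow_left₀ (by positivity) (by nlinarith) 2
    have h3 : (t ^ 2) ^ 2 ≤ (2 * (t ^ 2 - 1)) ^ 2 :=
      pow_le_pow_left₀ (by positivity) (by nlinarith) 2
    nlinarith
  have hiter : ∀ n : ℕ, ∀ t, T ≤ t → (w t / (t ^ 2 - 1)) ^ 2 * t ^ 3 ≤ 4 * (1 / 4) ^ n := by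
    intro n
    induction n with
    | zero => simpa using hb0
    | succ n ih =>
      intro t ht
      refine ((legendre_decay_step hν hg hw hwlim hglim hT (by positivity) ih) t ht).1.trans
        (le_of_eq ?_)
      ring
  have hpow : Tendsto (fun n : ℕ => (1 / 4 : ℝ) ^ n) atTop (𝓝 0) :=
    tendsto_pow_atTop_nhds_zero_of_lt_one (by norm_num) (by norm_num)
  have hbig : ∀ t, T ≤ t → w t = 0 ∧ g t = 0 := by
    intro t ht
    have ht0 : 0 < t := by linarith
    have hA : t ^ 2 - 1 ≠ 0 := by nlinarith
    have h1 : (w t / (t ^ 2 - 1)) ^ 2 * t ^ 3 ≤ 4 * 0 :=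
      ge_of_tendsto' (hpow.const_mul 4) fun n => hiter n t ht
    have h2 : g t ^ 2 * t ^ 3 ≤ 2 * (4 * 0) :=
      ge_of_tendsto' ((hpow.const_mul 4).const_mul 2) fun n =>
        ((legendre_decay_step hν hg hw hwlim hglim hT (by positivity) (hiter n)) t ht).2
    have ht3 : 0 < t ^ 3 := by positivity
    have h3 : (w t / (t ^ 2 - 1)) ^ 2 = 0 :=
      le_antisymm (by by_contra! hc; nlinarith) (sq_nonneg _)
    have h4 : g t ^ 2 = 0 := le_antisymm (by by_contra! hc; nlinarith) (sq_nonneg _)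
    refine ⟨?_, by simpa using h4⟩
    simpa [hA] using h3
  rcases le_total T t with hTt | htT
  · exact (hbig t hTt).2
  -- To go back from `T` towards `1`: since `ν < 0`, this energy is nonnegative and nondecreasing,
  -- and it is `0` at `T`.
  have hJ := le_of_hasDerivAt_nonneg (F := fun t => w t ^ 2 - ν * (t ^ 2 - 1) * g t ^ 2)
    (F' := fun t => -ν * (2 * t) * g t ^ 2) htT ?_ ?_
  · rw [(hbig T le_rfl).1, (hbig T le_rfl).2] at hJ
    have hA : 0 < t ^ 2 - 1 := by nlinarith
    have h1 : 0 < -ν * (t ^ 2 - 1) := mul_pos (by linarith) hA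
    have h2 : g t ^ 2 = 0 := le_antisymm
      (by by_contra! hc; nlinarith [mul_pos h1 hc, sq_nonneg (w t)]) (sq_nonneg _)
    simpa using h2
  · intro s hs
    have hs1 : 1 < s := ht.trans_le hs.1
    have hA' : s ^ 2 - 1 ≠ 0 := by nlinarith
    refine (((hw s hs1).pow 2).sub (((((hasDerivAt_id s).pow 2).sub_const 1).const_mul ν).mul
      ((hg s hs1).pow 2))).congr_deriv ?_
    simp only [id, Pi.pow_apply]
    field_simp
    ring
  · intro s hs
    have hs1 : 0 < s := by linarith [hs.1]
    have : 0 < -ν := by linarith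
    positivity

end RealLegendre

/-! ### Vanishing of square-integrable complex solutions -/

namespace IsLegendreSolution

variable {ν : ℂ} {g w : ℝ → ℂ}

theorem hasDerivAt_components (h : IsLegendreSolution ν g w) {t : ℝ} (ht : 1 < t) :
    HasDerivAt (fun t => (g t).re) ((w t).re / (t ^ 2 - 1)) t ∧
    HasDerivAt (fun t => (g t).im) ((w t).im / (t ^ 2 - 1)) t ∧
    HasDerivAt (fun t => (w t).re) (ν.re * (g t).re - ν.im * (g t).im) t ∧
    HasDerivAt (fun t => (w t).im) (ν.re * (g t).im + ν.im * (g t).re) t := by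
  obtain ⟨h1, h2⟩ := h t ht
  have re {F : ℝ → ℂ} {F' : ℂ} (hF : HasDerivAt F F' t) : HasDerivAt (fun t => (F t).re) F'.re t :=
    Complex.reCLM.hasFDerivAt.comp_hasDerivAt t hF
  have im {F : ℝ → ℂ} {F' : ℂ} (hF : HasDerivAt F F' t) : HasDerivAt (fun t => (F t).im) F'.im t :=
    Complex.imCLM.hasFDerivAt.comp_hasDerivAt t hF
  refine ⟨?_, ?_, ?_, ?_⟩
  · simpa only [Complex.div_ofReal_re] using re h1
  · simpa only [Complex.div_ofReal_im] using im h1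
  · simpa only [Complex.mul_re] using re h2
  · simpa only [Complex.mul_im] using im h2

/-- For real `ν ≤ -1/4`, Legendre's equation has no square-integrable solution on `(1, ∞)`. -/
theorem eq_zero_of_le (h : IsLegendreSolution ν g w)
    (hg : IntegrableOn (fun t => ‖g t‖ ^ 2) (Ioi 1)) (hre : ν.re ≤ -(1 / 4)) (him : ν.im = 0)
    {t : ℝ} (ht : 1 < t) : g t = 0 := by
  have hwl := h.tendsto_div_sqrt hg
  have hgl := h.tendsto_sqrt_mul hg
  refine Complex.ext ?_ ?_
  · refine legendre_eq_zero_of_decay (g := fun t => (g t).re) (w := fun t => (w t).re) hre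
      (fun t ht => (h.hasDerivAt_components ht).1)
      (fun t ht => by simpa [him] using (h.hasDerivAt_components ht).2.2.1) ?_ ?_ ht
    · simpa [Function.comp_def, Complex.div_ofReal_re] using
        (Complex.continuous_re.tendsto 0).comp hwl
    · simpa [Function.comp_def] using (Complex.continuous_re.tendsto 0).comp hgl
  · refine legendre_eq_zero_of_decay (g := fun t => (g t).im) (w := fun t => (w t).im) hre
      (fun t ht => (h.hasDerivAt_components ht).2.1)
      (fun t ht => by simpa [him] using (h.hasDerivAt_components ht).2.2.2) ?_ ?_ ht
    · simpa [Function.comp_def, Complex.div_ofReal_im] using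
        (Complex.continuous_im.tendsto 0).comp hwl
    · simpa [Function.comp_def] using (Complex.continuous_im.tendsto 0).comp hgl

/-- Legendre's equation has no square-integrable solution on `(1, ∞)` that is regular at `1`. -/
theorem eq_zero_of_regular (h : IsLegendreSolution ν g w)
    (hg : IntegrableOn (fun t => ‖g t‖ ^ 2) (Ioi 1)) (hw0 : Tendsto w (𝓝[>] 1) (𝓝 0))
    {t : ℝ} (ht : 1 < t) : g t = 0 := by
  obtain ⟨C, hC⟩ := h.exists_bounds_near_one hg hw0
  have hnear : ∀ᶠ t in 𝓝[>] (1 : ℝ), ‖g t‖ ≤ C := by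
    filter_upwards [Ioc_mem_nhdsGT (show (1 : ℝ) < 2 by norm_num)] with t ht using hC t ht.1 ht.2
  have hP1 : Tendsto (fun t => w t * (starRingEnd ℂ) (g t)) (𝓝[>] 1) (𝓝 0) := by
    refine hw0.zero_mul_isBoundedUnder_le ⟨C, ?_⟩
    simpa [Filter.eventually_map] using hnear
  have hQ1 : Tendsto (fun t : ℝ => (t - 1) * ((g t).re ^ 2 + (g t).im ^ 2)) (𝓝[>] 1) (𝓝 0) := by
    have h0 : Tendsto (fun t : ℝ => t - 1) (𝓝[>] 1) (𝓝 0) := by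
      simpa using ((continuous_id.sub continuous_const).tendsto (1 : ℝ)).mono_left
        (nhdsWithin_le_nhds (s := Ioi 1)) (f := fun t : ℝ => t - 1)
    refine h0.zero_mul_isBoundedUnder_le ⟨C ^ 2, ?_⟩
    rw [Filter.eventually_map]
    filter_upwards [hnear] with t ht
    have : (g t).re ^ 2 + (g t).im ^ 2 = ‖g t‖ ^ 2 := by
      rw [Complex.sq_norm, Complex.normSq_apply]; ring
    simp only [Function.comp]
    rw [this, Real.norm_of_nonneg (by positivity)]
    exact pow_le_pow_left₀ (norm_nonneg _) ht 2
  have hwl := h.tendsto_div_sqrt hg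
  have hgl := h.tendsto_sqrt_mul hg
  have hPinf : Tendsto (fun t => w t * (starRingEnd ℂ) (g t)) atTop (𝓝 0) := by
    have := hwl.mul ((Complex.continuous_conj.tendsto 0).comp hgl)
    rw [zero_mul] at this
    refine this.congr' ?_
    filter_upwards [eventually_gt_atTop 0] with t ht
    have : ((√t : ℝ) : ℂ) ≠ 0 := Complex.ofReal_ne_zero.2 (Real.sqrt_pos.2 ht).ne'
    simp only [Function.comp, map_mul, Complex.conj_ofReal]
    field_simp
  have hQinf : Tendsto (fun t : ℝ => (t - 1) * ((g t).re ^ 2 + (g t).im ^ 2)) atTop (𝓝 0) := by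
    have := hgl.norm.pow 2
    rw [norm_zero, zero_pow two_ne_zero] at this
    refine squeeze_zero' ?_ ?_ this
    · filter_upwards [eventually_ge_atTop 1] with t ht
      have : 0 ≤ t - 1 := by linarith
      positivity
    · filter_upwards [eventually_ge_atTop 1] with t ht
      rw [norm_mul, mul_pow, Complex.norm_real, Real.norm_of_nonneg (Real.sqrt_nonneg t),
        Real.sq_sqrt (by linarith), Complex.sq_norm, Complex.normSq_apply]
      nlinarith [sq_nonneg (g t).re, sq_nonneg (g t).im]
  have hIm : ∀ z v : ℂ, (z * (starRingEnd ℂ) v).im = z.im * v.re - z.re * v.im := by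
    intro z v; simp [Complex.mul_im]; ring
  have hRe : ∀ z v : ℂ, (z * (starRingEnd ℂ) v).re = z.re * v.re + z.im * v.im := by
    intro z v; simp [Complex.mul_re]
  have im_lim {l : Filter ℝ} (hl : Tendsto (fun t => w t * (starRingEnd ℂ) (g t)) l (𝓝 0)) :
      Tendsto (fun t => (w t).im * (g t).re - (w t).re * (g t).im) l (𝓝 0) := by
    simpa only [Function.comp_def, hIm, Complex.zero_im] using
      (Complex.continuous_im.tendsto 0).comp hl
  have re_lim {l : Filter ℝ} (hl : Tendsto (fun t => w t * (starRingEnd ℂ) (g t)) l (𝓝 0)) :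
      Tendsto (fun t => (w t).re * (g t).re + (w t).im * (g t).im) l (𝓝 0) := by
    simpa only [Function.comp_def, hRe, Complex.zero_re] using
      (Complex.continuous_re.tendsto 0).comp hl
  by_cases him : ν.im = 0
  · by_cases hre : ν.re ≤ -(1 / 4)
    · exact h.eq_zero_of_le hg hre him ht
    push Not at hre
    have hZ1 := (re_lim hP1).add (hQ1.const_mul (1 / 2))
    have hZinf := (re_lim hPinf).add (hQinf.const_mul (1 / 2))
    simp only [mul_zero, add_zero] at hZ1 hZinf
    -- Derivative of `Re(w ḡ) + (t - 1)|g|²/2`, arranged as squares through `t² - 1 = 2(t - 1) + (t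
    -- - 1)²`; the coefficient `ν + 1/4` of `|g|²` is positive.
    have key := deriv_eq_zero_of_tendsto
      (F' := fun t => (ν.re + 1 / 4) * ((g t).re ^ 2 + (g t).im ^ 2)
        + 2 * (t - 1) * (((w t).re / (t ^ 2 - 1)) ^ 2 + ((w t).im / (t ^ 2 - 1)) ^ 2)
        + ((t - 1) * ((w t).re / (t ^ 2 - 1)) + (g t).re / 2) ^ 2
        + ((t - 1) * ((w t).im / (t ^ 2 - 1)) + (g t).im / 2) ^ 2) ?_ ?_ hZ1 hZinf ht
    · have h0 : 0 < ν.re + 1 / 4 := by linarith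
      have h1 : 0 ≤ 2 * (t - 1) *
          (((w t).re / (t ^ 2 - 1)) ^ 2 + ((w t).im / (t ^ 2 - 1)) ^ 2) := by
        have : 0 ≤ t - 1 := by linarith
        positivity
      have h2 := sq_nonneg ((t - 1) * ((w t).re / (t ^ 2 - 1)) + (g t).re / 2)
      have h3 := sq_nonneg ((t - 1) * ((w t).im / (t ^ 2 - 1)) + (g t).im / 2)
      have h4 : (g t).re ^ 2 + (g t).im ^ 2 ≤ 0 := by by_contra! hc; nlinarith [mul_pos h0 hc]
      exact Complex.ext (pow_eq_zero_iff two_ne_zero |>.1 (by nlinarith [sq_nonneg (g t).re, sq_nonneg (g t).im]))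
        (pow_eq_zero_iff two_ne_zero |>.1 (by nlinarith [sq_nonneg (g t).re, sq_nonneg (g t).im]))
    · intro t ht
      obtain ⟨d1, d2, d3, d4⟩ := h.hasDerivAt_components ht
      have hA : t ^ 2 - 1 ≠ 0 := by nlinarith
      refine (((d3.mul d1).add (d4.mul d2)).add
        ((((hasDerivAt_id t).sub_const 1).mul ((d1.pow 2).add (d2.pow 2))).const_mul
          (1 / 2))).congr_deriv ?_
      simp only [id, Pi.pow_apply, Pi.add_apply, him]
      field_simp
      ring
    · intro t ht
      have h0 : 0 < ν.re + 1 / 4 := by linarith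
      have : 0 ≤ t - 1 := by linarith
      positivity
  · have hI1 := (im_lim hP1).const_mul ν.im
    have hIinf := (im_lim hPinf).const_mul ν.im
    rw [mul_zero] at hI1 hIinf
    have key := deriv_eq_zero_of_tendsto
      (F' := fun t => ν.im ^ 2 * ((g t).re ^ 2 + (g t).im ^ 2)) ?_ ?_ hI1 hIinf ht
    · have h4 : (g t).re ^ 2 + (g t).im ^ 2 = 0 := by simpa [him] using key
      exact Complex.ext (pow_eq_zero_iff two_ne_zero |>.1 (by nlinarith [sq_nonneg (g t).re, sq_nonneg (g t).im]))
        (pow_eq_zero_iff two_ne_zero |>.1 (by nlinarith [sq_nonneg (g t).re, sq_nonneg (g t).im]))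
    · intro t ht
      obtain ⟨d1, d2, d3, d4⟩ := h.hasDerivAt_components ht
      have hA : t ^ 2 - 1 ≠ 0 := by nlinarith
      refine (((d4.mul d1).sub (d3.mul d2)).const_mul ν.im).congr_deriv ?_
      field_simp
      ring
    · intro t ht
      positivity

end IsLegendreSolution

/-! ### Reduction to Legendre's equation -/

/-- The change of variable `x = 2p / (d t - s)`, with `s = a₁ + a₂`, `p = -a₁ a₂`, `d = ±(a₂ - a₁)`,
that maps `(1, ∞)` to one of the intervals `(a₁, 0)` and `(0, a₂)`. -/
noncomputable def legendreVar (a₁ a₂ d t : ℝ) : ℝ := 2 * (-(a₁ * a₂)) / (d * t - (a₁ + a₂))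

section Transform

variable {a₁ a₂ d : ℝ}

theorem hasDerivAt_legendreVar {t : ℝ} (ht : d * t - (a₁ + a₂) ≠ 0) :
    HasDerivAt (legendreVar a₁ a₂ d) (2 * (a₁ * a₂) * d / (d * t - (a₁ + a₂)) ^ 2) t := by
  have h := (hasDerivAt_const t (2 * (-(a₁ * a₂)))).div
    (((hasDerivAt_id t).const_mul d).sub_const (a₁ + a₂)) ht
  refine h.congr_deriv ?_
  simp only [id]
  ring

/-- The function `x f(x)` in the variable `t`. -/
noncomputable def legendreFun (a₁ a₂ d : ℝ) (f : ℝ → ℂ) (t : ℝ) : ℂ :=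
  (legendreVar a₁ a₂ d t : ℂ) * f (legendreVar a₁ a₂ d t)

/-- The quasi-derivative of `legendreFun`. -/
noncomputable def legendreQuasiDeriv (a₁ a₂ d : ℝ) (f : ℝ → ℂ) (t : ℝ) : ℂ :=
  ((2 / d : ℝ) : ℂ) * ((coeffP a₁ a₂ (legendreVar a₁ a₂ d t) : ℂ) * deriv f (legendreVar a₁ a₂ d t)
      / (legendreVar a₁ a₂ d t : ℂ)
    + ((legendreVar a₁ a₂ d t - a₁ : ℝ) : ℂ) * ((legendreVar a₁ a₂ d t - a₂ : ℝ) : ℂ)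
      * f (legendreVar a₁ a₂ d t))

/-- Both equations become identities in `x`, through `x' = d x² / (2 a₁a₂)` and the formula `hAx`
for `t² - 1`. In the second, the `f'` terms cancel because `P/x² = (x - a₁)(x - a₂)`. The
`x`-dependent part `2x² - (a₁ + a₂)x` of `Q` cancels too, leaving the constant `(a₁ + a₂)²/8`. -/
theorem isLegendreSolution_of_isSolutionOn (h0 : a₁ * a₂ ≠ 0) (hd0 : d ≠ 0)
    (hd : d ^ 2 = (a₂ - a₁) ^ 2) {I : Set ℝ} (hden : ∀ t, 1 < t → d * t - (a₁ + a₂) ≠ 0)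
    (hI : ∀ t, 1 < t → legendreVar a₁ a₂ d t ∈ I) {lam : ℂ} {f : ℝ → ℂ}
    (hf : IsSolutionOn a₁ a₂ I lam f) :
    IsLegendreSolution ((((a₁ + a₂) ^ 2 / 8 : ℝ) - lam) / ((-(a₁ * a₂) : ℝ) : ℂ))
      (legendreFun a₁ a₂ d f) (legendreQuasiDeriv a₁ a₂ d f) := by
  intro t ht
  obtain ⟨hf1, hf2⟩ := hf _ (hI t ht)
  have hx := hasDerivAt_legendreVar (hden t ht)
  have hxc := hx.ofReal_comp
  have hfx := hf1.hasDerivAt.scomp t hx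
  have hwx := hf2.scomp t hx
  have hy0 := hden t ht
  have hA : t ^ 2 - 1 ≠ 0 := by nlinarith
  have hx0 : legendreVar a₁ a₂ d t ≠ 0 :=
    div_ne_zero (mul_ne_zero two_ne_zero (neg_ne_zero.2 h0)) hy0
  set x := legendreVar a₁ a₂ d t with hxdef
  have hx' : 2 * (a₁ * a₂) * d / (d * t - (a₁ + a₂)) ^ 2 = d / (2 * (a₁ * a₂)) * x ^ 2 := by
    rw [hxdef, legendreVar]
    field_simp
  have htx : t = (2 * (-(a₁ * a₂)) / x + (a₁ + a₂)) / d := by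
    rw [hxdef, legendreVar]
    have := left_ne_zero_of_mul h0
    have := right_ne_zero_of_mul h0
    field_simp
    ring
  have hAx : t ^ 2 - 1 = 4 * (a₁ * a₂) * ((x - a₁) * (x - a₂)) / (x ^ 2 * d ^ 2) := by
    rw [htx]
    field_simp
    rw [hd]
    ring
  have hx1 : x - a₁ ≠ 0 := fun h => hA (by rw [hAx, h]; simp)
  have hx2 : x - a₂ ≠ 0 := fun h => hA (by rw [hAx, h]; simp)
  have ha₁ := left_ne_zero_of_mul h0
  have ha₂ := right_ne_zero_of_mul h0
  have e0 : (x : ℂ) ≠ 0 := Complex.ofReal_ne_zero.2 hx0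
  have e1 : (x : ℂ) - a₁ ≠ 0 := by exact_mod_cast hx1
  have e2 : (x : ℂ) - a₂ ≠ 0 := by exact_mod_cast hx2
  have e3 : (a₁ : ℂ) ≠ 0 := Complex.ofReal_ne_zero.2 ha₁
  have e4 : (a₂ : ℂ) ≠ 0 := Complex.ofReal_ne_zero.2 ha₂
  have e5 : (d : ℂ) ≠ 0 := Complex.ofReal_ne_zero.2 hd0
  rw [hx'] at hxc hfx hwx hx
  constructor
  · refine (hxc.mul hfx).congr_deriv ?_
    simp only [Function.comp_def, legendreQuasiDeriv, ← hxdef, hAx, coeffP, Complex.real_smul]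
    push_cast
    field_simp
    ring
  · refine (((hwx.div hxc e0).add (((hx.sub_const a₁).ofReal_comp.mul
      (hx.sub_const a₂).ofReal_comp).mul hfx)).const_mul ((2 / d : ℝ) : ℂ)).congr_deriv ?_
    simp only [Function.comp_def, legendreFun, ← hxdef, coeffP, coeffQ, Complex.real_smul,
      Pi.mul_apply]
    push_cast
    field_simp
    ring

theorem injOn_legendreVar (h0 : a₁ * a₂ ≠ 0) (hd0 : d ≠ 0)
    (hden : ∀ t, 1 < t → d * t - (a₁ + a₂) ≠ 0) : InjOn (legendreVar a₁ a₂ d) (Ioi 1) := by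
  intro t ht s hs hts
  have h1 := hden t ht
  have h2 := hden s hs
  have h3 : 2 * (-(a₁ * a₂)) ≠ 0 := mul_ne_zero two_ne_zero (neg_ne_zero.2 h0)
  rw [legendreVar, legendreVar, div_eq_div_iff h1 h2] at hts
  have h4 := mul_left_cancel₀ h3 hts
  exact mul_left_cancel₀ hd0 (by linarith)

theorem integrableOn_legendreFun (h0 : a₁ * a₂ ≠ 0) (hd0 : d ≠ 0) {I : Set ℝ}
    (hden : ∀ t, 1 < t → d * t - (a₁ + a₂) ≠ 0)
    (hI : ∀ t, 1 < t → legendreVar a₁ a₂ d t ∈ I) {f : ℝ → ℂ} (hf : SquareIntegrableOn I f) :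
    IntegrableOn (fun t => ‖legendreFun a₁ a₂ d f t‖ ^ 2) (Ioi 1) := by
  have h1 : IntegrableOn (fun x => ‖f x‖ ^ 2) I :=
    (memLp_two_iff_integrable_sq_norm hf.aestronglyMeasurable).1 hf
  have h2 := h1.mono_set (image_subset_iff.2 hI : legendreVar a₁ a₂ d '' Ioi 1 ⊆ I)
  rw [integrableOn_image_iff_integrableOn_abs_deriv_smul measurableSet_Ioi
    (fun t ht => (hasDerivAt_legendreVar (hden t ht)).hasDerivWithinAt)
    (injOn_legendreVar h0 hd0 hden)] at h2
  refine IntegrableOn.congr_fun (h2.const_mul |2 * (a₁ * a₂) / d|) (fun t ht => ?_) measurableSet_Ioi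
  have h3 := hden t ht
  simp only [smul_eq_mul, legendreFun, norm_mul, Complex.norm_real, Real.norm_eq_abs, mul_pow,
    sq_abs]
  rw [← mul_assoc, ← abs_mul]
  congr 1
  have : 2 * (a₁ * a₂) / d * (2 * (a₁ * a₂) * d / (d * t - (a₁ + a₂)) ^ 2)
      = legendreVar a₁ a₂ d t ^ 2 := by
    rw [legendreVar]; field_simp
  rw [this, abs_of_nonneg (sq_nonneg _)]

/-- The boundary condition handles only the `P f'` term. In the other, `(x - a₁)(x - a₂)` is a
multiple of `(t² - 1) x²`, so that term is a bounded factor times `(t - 1) g`, small by `hlog`. -/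
theorem tendsto_legendreQuasiDeriv (h0 : a₁ * a₂ ≠ 0)
    (hd : d ^ 2 = (a₂ - a₁) ^ 2) {I : Set ℝ} {e : ℝ}
    (hden : ∀ t, 1 ≤ t → d * t - (a₁ + a₂) ≠ 0)
    (hI : ∀ t, 1 < t → legendreVar a₁ a₂ d t ∈ I) (he : legendreVar a₁ a₂ d 1 = e) {f : ℝ → ℂ}
    (hbc : Tendsto (fun x : ℝ => (coeffP a₁ a₂ x : ℂ) * deriv f x) (𝓝[I] e) (𝓝 0))
    (hlog : Tendsto (fun t : ℝ => ((t - 1 : ℝ) : ℂ) * legendreFun a₁ a₂ d f t) (𝓝[>] 1) (𝓝 0)) :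
    Tendsto (legendreQuasiDeriv a₁ a₂ d f) (𝓝[>] 1) (𝓝 0) := by
  have hcont : Tendsto (legendreVar a₁ a₂ d) (𝓝[>] 1) (𝓝 e) := by
    rw [← he]
    exact (hasDerivAt_legendreVar (hden 1 le_rfl)).continuousAt.tendsto.mono_left nhdsWithin_le_nhds
  have hcontI : Tendsto (legendreVar a₁ a₂ d) (𝓝[>] 1) (𝓝[I] e) :=
    tendsto_nhdsWithin_iff.2 ⟨hcont, by filter_upwards [self_mem_nhdsWithin] with t ht using hI t ht⟩
  have he0 : e ≠ 0 := by
    rw [← he]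
    exact div_ne_zero (mul_ne_zero two_ne_zero (neg_ne_zero.2 h0)) (hden 1 le_rfl)
  have hcc : Tendsto (fun t => (legendreVar a₁ a₂ d t : ℂ)) (𝓝[>] 1) (𝓝 (e : ℂ)) :=
    (Complex.continuous_ofReal.tendsto e).comp hcont
  have h1 := (hbc.comp hcontI).div hcc (Complex.ofReal_ne_zero.2 he0)
  have h2 : Tendsto (fun t : ℝ => ((t + 1 : ℝ) : ℂ) * (d ^ 2 / (4 * (a₁ * a₂)))
      * (legendreVar a₁ a₂ d t : ℂ)) (𝓝[>] 1) (𝓝 (((1 + 1 : ℝ) : ℂ) * (d ^ 2 / (4 * (a₁ * a₂))) * e)) := by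
    refine Tendsto.mul ?_ hcc
    exact ((by fun_prop : Continuous fun t : ℝ => ((t + 1 : ℝ) : ℂ) *
      ((d : ℂ) ^ 2 / (4 * (a₁ * a₂)))).tendsto 1).mono_left nhdsWithin_le_nhds
  have h3 := (h1.add (h2.mul hlog)).const_mul ((2 / d : ℝ) : ℂ)
  rw [zero_div, mul_zero, add_zero, mul_zero] at h3
  refine h3.congr' ?_
  filter_upwards [self_mem_nhdsWithin] with t ht
  have hy0 := hden t (le_of_lt ht)
  simp only [legendreQuasiDeriv, legendreFun, Function.comp_def, Pi.div_apply]
  have key : (t + 1) * (d ^ 2 / (4 * (a₁ * a₂))) * legendreVar a₁ a₂ d t *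
      ((t - 1) * legendreVar a₁ a₂ d t)
      = (legendreVar a₁ a₂ d t - a₁) * (legendreVar a₁ a₂ d t - a₂) := by
    have ha₁ := left_ne_zero_of_mul h0
    have ha₂ := right_ne_zero_of_mul h0
    rw [legendreVar]
    generalize hy : d * t - (a₁ + a₂) = y at hy0 ⊢
    field_simp
    subst hy
    linear_combination (-4 : ℝ) * hd
  have keyc := congrArg (fun r : ℝ => (r : ℂ)) key
  push_cast at keyc ⊢
  rw [← keyc]
  ring

theorem legendreVar_surj (h0 : a₁ * a₂ ≠ 0) (hd0 : d ≠ 0) {x : ℝ} (hx0 : x ≠ 0) :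
    legendreVar a₁ a₂ d ((2 * (-(a₁ * a₂)) / x + (a₁ + a₂)) / d) = x := by
  have ha₁ := left_ne_zero_of_mul h0
  have ha₂ := right_ne_zero_of_mul h0
  rw [legendreVar, mul_div_cancel₀ _ hd0, add_sub_cancel_right]
  field_simp

end Transform

/-! ### The two intervals as images of the half-line -/

section Geometry

variable {a₁ a₂ : ℝ}

theorem legendreVar_right (ha₁ : a₁ < 0) (ha₂ : 0 < a₂) :
    (∀ t, 1 ≤ t → (a₂ - a₁) * t - (a₁ + a₂) ≠ 0) ∧
    (∀ t, 1 < t → legendreVar a₁ a₂ (a₂ - a₁) t ∈ Ioo 0 a₂) ∧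
    legendreVar a₁ a₂ (a₂ - a₁) 1 = a₂ ∧
    ∀ x ∈ Ioo 0 a₂, 1 < (2 * (-(a₁ * a₂)) / x + (a₁ + a₂)) / (a₂ - a₁) := by
  have hp : 0 < -(a₁ * a₂) := by nlinarith
  have hd : 0 < a₂ - a₁ := by linarith
  refine ⟨fun t ht => ne_of_gt (by nlinarith), fun t ht => ?_, ?_, fun x hx => ?_⟩
  · have hy : 0 < (a₂ - a₁) * t - (a₁ + a₂) := by nlinarith
    refine ⟨div_pos (by linarith) hy, ?_⟩
    rw [legendreVar, div_lt_iff₀ hy]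
    nlinarith [mul_pos (mul_pos ha₂ hd) (sub_pos.2 ht)]
  · rw [legendreVar, div_eq_iff (by linarith)]
    ring
  · rw [lt_div_iff₀ hd, ← sub_lt_iff_lt_add, lt_div_iff₀ hx.1]
    nlinarith [mul_pos (neg_pos.2 ha₁) (sub_pos.2 hx.2)]

theorem legendreVar_left (ha₁ : a₁ < 0) (ha₂ : 0 < a₂) :
    (∀ t, 1 ≤ t → (a₁ - a₂) * t - (a₁ + a₂) ≠ 0) ∧
    (∀ t, 1 < t → legendreVar a₁ a₂ (a₁ - a₂) t ∈ Ioo a₁ 0) ∧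
    legendreVar a₁ a₂ (a₁ - a₂) 1 = a₁ ∧
    ∀ x ∈ Ioo a₁ 0, 1 < (2 * (-(a₁ * a₂)) / x + (a₁ + a₂)) / (a₁ - a₂) := by
  have hp : 0 < -(a₁ * a₂) := by nlinarith
  have hd : a₁ - a₂ < 0 := by linarith
  refine ⟨fun t ht => ne_of_lt (by nlinarith), fun t ht => ?_, ?_, fun x hx => ?_⟩
  · have hy : (a₁ - a₂) * t - (a₁ + a₂) < 0 := by nlinarith
    refine ⟨?_, div_neg_of_pos_of_neg (by linarith) hy⟩
    rw [legendreVar, lt_div_iff_of_neg hy]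
    nlinarith [mul_pos (mul_pos_of_neg_of_neg ha₁ hd) (sub_pos.2 ht)]
  · rw [legendreVar, div_eq_iff (by linarith)]
    ring
  · rw [lt_div_iff_of_neg hd, ← lt_sub_iff_add_lt, div_lt_iff_of_neg hx.2]
    nlinarith [mul_pos ha₂ (sub_pos.2 hx.1)]

end Geometry

/-! ### Return to the Sturm–Liouville problems -/

theorem eq_zero_of_isSolutionOn {a₁ a₂ d : ℝ} (ha₁ : a₁ < 0) (ha₂ : 0 < a₂)
    (hd : d ^ 2 = (a₂ - a₁) ^ 2) {I : Set ℝ} {e : ℝ}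
    (hgeom : (∀ t, 1 ≤ t → d * t - (a₁ + a₂) ≠ 0) ∧ (∀ t, 1 < t → legendreVar a₁ a₂ d t ∈ I) ∧
      legendreVar a₁ a₂ d 1 = e ∧ ∀ x ∈ I, 1 < (2 * (-(a₁ * a₂)) / x + (a₁ + a₂)) / d)
    (hI0 : ∀ x ∈ I, x ≠ 0) {lam : ℂ} {f : ℝ → ℂ} (hf : IsSolutionOn a₁ a₂ I lam f)
    (hL : SquareIntegrableOn I f)
    (hcase : Tendsto (fun x : ℝ => (coeffP a₁ a₂ x : ℂ) * deriv f x) (𝓝[I] e) (𝓝 0) ∨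
      (lam.im = 0 ∧ (a₁ ^ 2 + a₂ ^ 2) / 8 ≤ lam.re)) : ∀ x ∈ I, f x = 0 := by
  obtain ⟨hden, hI, he, hsurj⟩ := hgeom
  have hp : 0 < -(a₁ * a₂) := by nlinarith
  have h0 : a₁ * a₂ ≠ 0 := by linarith
  have hd0 : d ≠ 0 := by
    rintro rfl
    nlinarith
  have hden' := fun t (ht : 1 < t) => hden t ht.le
  have hsol := isLegendreSolution_of_isSolutionOn h0 hd0 hd hden' hI hf
  have hint := integrableOn_legendreFun h0 hd0 hden' hI hL
  have hzero : ∀ t, 1 < t → legendreFun a₁ a₂ d f t = 0 := by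
    intro t ht
    rcases hcase with hbc | ⟨him, hre⟩
    · exact hsol.eq_zero_of_regular hint (tendsto_legendreQuasiDeriv h0 hd hden hI he hbc
        (hsol.tendsto_sub_one_mul hint)) ht
    · refine hsol.eq_zero_of_le hint ?_ ?_ ht
      · rw [Complex.div_ofReal_re, Complex.sub_re, Complex.ofReal_re, div_le_iff₀ hp]
        -- The inequality is exactly the threshold, since `(a₁ + a₂)²/8 - (a₁² + a₂²)/8 = a₁a₂/4 =
        -- -p/4`.
        linarith
      · rw [Complex.div_ofReal_im, Complex.sub_im, Complex.ofReal_im, him, sub_zero, zero_div]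
  intro x hx
  have h1 := hzero _ (hsurj x hx)
  rw [legendreFun, legendreVar_surj h0 hd0 (hI0 x hx)] at h1
  exact (mul_eq_zero.1 h1).resolve_left (Complex.ofReal_ne_zero.2 (hI0 x hx))

theorem mainTheorem3 (a₁ a₂ : ℝ) (ha₁ : a₁ < 0) (ha₂ : 0 < a₂) :
    (∀ lam : ℂ, ¬ IsSLEigenvalue a₁ a₂ (Ioo a₁ 0) a₁ lam) ∧
    (∀ lam : ℂ, ¬ IsSLEigenvalue a₁ a₂ (Ioo 0 a₂) a₂ lam) ∧
    (∀ lam : ℝ, (a₁ ^ 2 + a₂ ^ 2) / 8 ≤ lam → ∀ f : ℝ → ℂ,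
      (IsSolutionOn a₁ a₂ (Ioo a₁ 0) (lam : ℂ) f → SquareIntegrableOn (Ioo a₁ 0) f →
        ∀ x ∈ Ioo a₁ 0, f x = 0) ∧
      (IsSolutionOn a₁ a₂ (Ioo 0 a₂) (lam : ℂ) f → SquareIntegrableOn (Ioo 0 a₂) f →
        ∀ x ∈ Ioo 0 a₂, f x = 0)) := by
  have hdl : (a₁ - a₂) ^ 2 = (a₂ - a₁) ^ 2 := by ring
  have hl := legendreVar_left ha₁ ha₂
  have hr := legendreVar_right ha₁ ha₂
  have hl0 : ∀ x ∈ Ioo a₁ 0, x ≠ 0 := fun x hx => hx.2.ne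
  have hr0 : ∀ x ∈ Ioo 0 a₂, x ≠ 0 := fun x hx => hx.1.ne'
  refine ⟨?_, ?_, fun lam hlam f => ⟨fun hf hL => ?_, fun hf hL => ?_⟩⟩
  · rintro lam ⟨f, hf, hbc, hL, x, hx, hfx⟩
    exact hfx (eq_zero_of_isSolutionOn ha₁ ha₂ hdl hl hl0 hf hL (Or.inl hbc) x hx)
  · rintro lam ⟨f, hf, hbc, hL, x, hx, hfx⟩
    exact hfx (eq_zero_of_isSolutionOn ha₁ ha₂ rfl hr hr0 hf hL (Or.inl hbc) x hx)
  · exact eq_zero_of_isSolutionOn ha₁ ha₂ hdl hl hl0 hf hL (Or.inr ⟨by simp, by simpa using hlam⟩)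
  · exact eq_zero_of_isSolutionOn ha₁ ha₂ rfl hr hr0 hf hL (Or.inr ⟨by simp, by simpa using hlam⟩)
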